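/- For $n\ge 1$ let $\mathcal{C}_n$ be the set of complex $n\times n$ matrices $T$ with $\|T\|\le 1$, where $\|\cdot\|$ is the operator norm associated with the Hilbert norm on $\mathbb{C}^n$, and let $\rho(T)$ be the spectral radius of $T$. For $r\in(0,1)$ put \[ \mathcal{R}_{n,r}=\sup\bigl\{\|(\zeta-T)^{-1}\| : T\in\mathcal{C}_n,\ \rho(T)\le r\bigr\},\qquad |\zeta|=1. \] This supremum is finite and does not depend on the choice of $\zeta$ on the unit circle, and for every fixed $r\in(0,1)$, \[ \mathcal{R}_{n,r}\sim\frac{2}{\pi}\,\frac{1+r}{1-r}\,n\qquad\text{as } n\to\infty . \] -/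

import Mathlib

open Filter Asymptotics

noncomputable section

/-- The operator norm of a complex `n × n` matrix with respect to the Hilbert norm on `ℂⁿ`. -/
def hilbertOpNorm {n : ℕ} (A : Matrix (Fin n) (Fin n) ℂ) : ℝ :=
  ‖Matrix.toEuclideanCLM (n := Fin n) (𝕜 := ℂ) A‖

/-- The values `‖(ζ - T)⁻¹‖`, where `T` ranges over the contractions on `ℂⁿ` whose spectral
radius does not exceed `r`. -/
def resolventNorms (n : ℕ) (r : ℝ) (ζ : ℂ) : Set ℝ :=
  {x | ∃ T : Matrix (Fin n) (Fin n) ℂ,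
    hilbertOpNorm T ≤ 1 ∧ spectralRadius ℂ T ≤ ENNReal.ofReal r ∧
      x = hilbertOpNorm (resolvent T ζ)}

/-- The supremum of `‖(ζ - T)⁻¹‖` over the contractions `T` on `ℂⁿ` with spectral radius at most
`r`, for `ζ` on the unit circle. The definition takes `ζ = 1`; that every other point of the unit
circle gives the same number is part of what the theorem asserts. -/
def resolventSup (n : ℕ) (r : ℝ) : ℝ :=
  sSup (resolventNorms n r 1)

end

/-! Upper bound: let `B = (1 - T)⁻¹` with `T` a contraction. Then `B + B* - 1` is positive
semidefinite. In an orthonormal basis making `B` upper triangular, its diagonal entries are `(1 -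
z)⁻¹` with `z` an eigenvalue of `T`, `‖z‖ ≤ r`, so the diagonal of `B + B* - 1` is at most `P = (1 +
r) / (1 - r)`. The `2 × 2` principal minors then bound every off-diagonal entry of `B` by `P`
(`norm_inner_le_of_norm_sq_le`). Hence `B` is dominated entrywise by `P • S`, with `S` the
triangular matrix of ones, and `‖S‖ = summationNorm n ∼ 2n/π` (`sum_sq_partialSum_le`,
`tendsto_summationNorm_div`).

Lower bound: for the nilpotent Jordan block `J`, the Möbius transform `T = (J + r)(1 + rJ)⁻¹` is a
contraction with no spectrum besides `r`, and `(1 - T)⁻¹ = ((1 + r)S - r) / (1 - r)`. Both bounds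
have the same leading term in `n`. -/

/-- The Hilbert norm of the `n × n` triangular matrix all of whose nonzero entries are `1`. -/
noncomputable def summationNorm (n : ℕ) : ℝ :=
  1 / (2 * Real.sin (Real.pi / (2 * (2 * n + 1))))

/-! ### Norm of the triangular matrix of ones, by explicit singular vectors. -/

section SummationMatrix

open Finset

theorem two_mul_sin_mul_sum_cos (φ : ℝ) (m : ℕ) :
    2 * Real.sin φ * ∑ i ∈ range m, Real.cos ((2 * i + 1) * φ) = Real.sin (2 * m * φ) := by
  induction m with
  | zero => simp
  | succ m ih =>
    rw [sum_range_succ, mul_add, ih]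
    have h₁ : (2 * (m : ℝ) + 1) * φ = 2 * m * φ + φ := by ring
    have h₂ : 2 * ((m + 1 : ℕ) : ℝ) * φ = 2 * m * φ + 2 * φ := by push_cast; ring
    rw [h₁, h₂, Real.cos_add, Real.sin_add, Real.sin_two_mul, Real.cos_two_mul]
    have := Real.sin_sq_add_cos_sq φ
    linear_combination -2 * Real.sin (2 * m * φ) * this

theorem two_mul_sin_mul_sum_sin (φ : ℝ) {k n : ℕ} (h : k ≤ n) :
    2 * Real.sin φ * ∑ j ∈ Ico k n, Real.sin (2 * (j + 1) * φ) =
      Real.cos ((2 * k + 1) * φ) - Real.cos ((2 * n + 1) * φ) := by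
  induction n, h using Nat.le_induction with
  | base => simp
  | succ m hm ih =>
    rw [sum_Ico_succ_top hm, mul_add, ih]
    have h₁ : (2 * (m : ℝ) + 1) * φ = 2 * (m + 1) * φ - φ := by ring
    have h₂ : (2 * ((m + 1 : ℕ) : ℝ) + 1) * φ = 2 * (m + 1) * φ + φ := by push_cast; ring
    rw [h₁, h₂, Real.cos_add, Real.cos_sub]
    ring

variable {n : ℕ}

theorem sum_ite_ge_eq_sum_Ico (f : ℕ → ℝ) (i : Fin n) :
    ∑ j : Fin n, (if i ≤ j then f j else 0) = ∑ j ∈ Ico (i : ℕ) n, f j := by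
  simp only [Fin.le_def]
  rw [Fin.sum_univ_eq_sum_range (fun j => if (i : ℕ) ≤ j then f j else 0) n, ← sum_filter]
  congr 1
  ext j
  simp [and_comm]

theorem sum_ite_le_eq_sum_range (f : ℕ → ℝ) (j : Fin n) :
    ∑ i : Fin n, (if i ≤ j then f i else 0) = ∑ i ∈ range (j + 1), f i := by
  simp only [Fin.le_def]
  rw [Fin.sum_univ_eq_sum_range (fun i => if i ≤ (j : ℕ) then f i else 0) n, ← sum_filter]
  congr 1
  ext i
  have := j.2
  simp only [mem_filter, mem_range]
  omega

/-- The quarter-period angle of the singular vectors of the summation matrix. -/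
noncomputable def summationAngle (n : ℕ) : ℝ := Real.pi / (2 * (2 * n + 1))

theorem summationAngle_pos (n : ℕ) : 0 < summationAngle n := by
  unfold summationAngle; positivity

theorem summationAngle_mul (n : ℕ) : (2 * (n : ℝ) + 1) * summationAngle n = Real.pi / 2 := by
  unfold summationAngle; field_simp

theorem sin_summationAngle_pos (n : ℕ) : 0 < Real.sin (summationAngle n) := by
  apply Real.sin_pos_of_pos_of_lt_pi (summationAngle_pos n)
  have h := summationAngle_mul n
  have := mul_nonneg (Nat.cast_nonneg (α := ℝ) n) (summationAngle_pos n).le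
  linarith [Real.pi_pos]

theorem summationNorm_pos (n : ℕ) : 0 < summationNorm n := by
  have := sin_summationAngle_pos n
  unfold summationAngle at this
  unfold summationNorm
  positivity

theorem two_mul_sin_mul_summationNorm (n : ℕ) :
    2 * Real.sin (summationAngle n) * summationNorm n = 1 := by
  have := sin_summationAngle_pos n
  unfold summationNorm
  change 2 * Real.sin (summationAngle n) * (1 / (2 * Real.sin (summationAngle n))) = 1
  field_simp

theorem sin_singular_pos (j : Fin n) :
    0 < Real.sin (2 * ((j : ℕ) + 1) * summationAngle n) := by
  have h := summationAngle_mul n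
  have h₀ := summationAngle_pos n
  have hj : ((j : ℕ) : ℝ) + 1 ≤ n := by exact_mod_cast j.2
  apply Real.sin_pos_of_pos_of_lt_pi (by positivity)
  nlinarith [Real.pi_pos]

/-- The telescoped sum loses its boundary term because the angle makes `(2n + 1)φ = π/2`. With
`sum_cos_singular`, the sine and cosine vectors form a singular pair for the value `summationNorm
n`. -/
theorem sum_sin_singular (i : Fin n) :
    ∑ j : Fin n, (if i ≤ j then Real.sin (2 * ((j : ℕ) + 1) * summationAngle n) else 0) =
      summationNorm n * Real.cos ((2 * (i : ℕ) + 1) * summationAngle n) := by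
  rw [sum_ite_ge_eq_sum_Ico (fun j => Real.sin (2 * (j + 1) * summationAngle n))]
  have h := two_mul_sin_mul_sum_sin (summationAngle n) i.2.le
  rw [summationAngle_mul, Real.cos_pi_div_two, sub_zero] at h
  rw [← h, ← mul_assoc, mul_comm (summationNorm n), two_mul_sin_mul_summationNorm, one_mul]

theorem sum_cos_singular (j : Fin n) :
    ∑ i : Fin n, (if i ≤ j then Real.cos ((2 * (i : ℕ) + 1) * summationAngle n) else 0) =
      summationNorm n * Real.sin (2 * ((j : ℕ) + 1) * summationAngle n) := by
  rw [sum_ite_le_eq_sum_range (fun i => Real.cos ((2 * i + 1) * summationAngle n))]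
  have h := two_mul_sin_mul_sum_cos (summationAngle n) (j + 1)
  push_cast at h
  rw [← h, ← mul_assoc, mul_comm (summationNorm n), two_mul_sin_mul_summationNorm, one_mul]

/-- Schur test: Cauchy–Schwarz on each row, weighted by the positive singular vector `s`, then the
transposed relation on each column. -/
theorem sum_sq_partialSum_le (x : Fin n → ℝ) :
    ∑ i, (∑ j, if i ≤ j then x j else 0) ^ 2 ≤ summationNorm n ^ 2 * ∑ j, x j ^ 2 := by
  set s : Fin n → ℝ := fun j => Real.sin (2 * ((j : ℕ) + 1) * summationAngle n) with hs
  set c : Fin n → ℝ := fun i => Real.cos ((2 * (i : ℕ) + 1) * summationAngle n) with hc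
  have hspos : ∀ j, 0 < s j := sin_singular_pos
  have key : ∀ i, (∑ j, if i ≤ j then x j else 0) ^ 2 ≤
      summationNorm n * c i * ∑ j, if i ≤ j then x j ^ 2 / s j else 0 := by
    intro i
    rw [hc, ← sum_sin_singular i]
    apply sum_sq_le_sum_mul_sum_of_sq_le_mul
    · intro j _; split_ifs; exacts [(hspos j).le, le_rfl]
    · intro j _; split_ifs; exacts [div_nonneg (sq_nonneg _) (hspos j).le, le_rfl]
    · intro j _
      split_ifs
      · have := (hspos j).ne'
        change x j ^ 2 ≤ s j * (x j ^ 2 / s j)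
        rw [mul_div_cancel₀ _ this]
      · simp
  calc ∑ i, (∑ j, if i ≤ j then x j else 0) ^ 2
      ≤ ∑ i, summationNorm n * c i * ∑ j, (if i ≤ j then x j ^ 2 / s j else 0) :=
        sum_le_sum fun i _ => key i
    _ = ∑ j, summationNorm n * (x j ^ 2 / s j) * ∑ i, (if i ≤ j then c i else 0) := by
        simp_rw [mul_sum]
        rw [sum_comm]
        refine sum_congr rfl fun j _ => sum_congr rfl fun i _ => ?_
        split_ifs <;> ring
    _ = summationNorm n ^ 2 * ∑ j, x j ^ 2 := by
        rw [mul_sum]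
        refine sum_congr rfl fun j _ => ?_
        rw [hc, sum_cos_singular j]
        change summationNorm n * (x j ^ 2 / s j) * (summationNorm n * s j) = _
        have := (hspos j).ne'
        field_simp

/-- The sine vector attains the bound of the Schur test. -/
theorem sum_sq_partialSum_sin (n : ℕ) :
    ∑ i : Fin n, (∑ j : Fin n,
        if i ≤ j then Real.sin (2 * ((j : ℕ) + 1) * summationAngle n) else 0) ^ 2 =
      summationNorm n ^ 2 * ∑ j : Fin n, Real.sin (2 * ((j : ℕ) + 1) * summationAngle n) ^ 2 := by
  set s : Fin n → ℝ := fun j => Real.sin (2 * ((j : ℕ) + 1) * summationAngle n) with hs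
  set c : Fin n → ℝ := fun i => Real.cos ((2 * (i : ℕ) + 1) * summationAngle n) with hc
  calc ∑ i, (∑ j, if i ≤ j then s j else 0) ^ 2
      = ∑ i, summationNorm n * c i * ∑ j, (if i ≤ j then s j else 0) :=
        sum_congr rfl fun i _ => by
          rw [sq]; congr 1; exact sum_sin_singular i
    _ = ∑ j, summationNorm n * s j * ∑ i, (if i ≤ j then c i else 0) := by
        simp_rw [mul_sum]
        rw [sum_comm]
        refine sum_congr rfl fun j _ => sum_congr rfl fun i _ => ?_
        split_ifs <;> ring
    _ = summationNorm n ^ 2 * ∑ j, s j ^ 2 := by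
        rw [mul_sum]
        refine sum_congr rfl fun j _ => ?_
        rw [hc, sum_cos_singular j]
        ring

theorem tendsto_summationNorm_div :
    Tendsto (fun n : ℕ => summationNorm n / n) atTop (nhds (2 / Real.pi)) := by
  have h₀ : Tendsto (fun n : ℕ => ((n : ℝ))⁻¹) atTop (nhds 0) :=
    tendsto_inv_atTop_zero.comp tendsto_natCast_atTop_atTop
  have hang : Tendsto summationAngle atTop (nhds 0) := by
    have h : Tendsto (fun n : ℕ => Real.pi / 2 * ((n : ℝ)⁻¹ / (2 + (n : ℝ)⁻¹))) atTop
        (nhds (Real.pi / 2 * (0 / (2 + 0)))) :=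
      (h₀.div (h₀.const_add 2) (by norm_num)).const_mul _
    simp only [zero_div, mul_zero] at h
    refine h.congr' ?_
    filter_upwards [eventually_ge_atTop 1] with n hn
    have : (0 : ℝ) < n := by exact_mod_cast hn
    unfold summationAngle
    field_simp
  have hsinc := (Real.continuous_sinc.tendsto 0).comp hang
  rw [Real.sinc_zero] at hsinc
  -- For `n ≥ 1`, `summationNorm n / n = ((2 + 1/n) / π) / sinc φ`, where `φ` is the summation
  -- angle.
  have h := ((h₀.const_add 2).div_const Real.pi).div hsinc one_ne_zero
  simp only [add_zero, div_one] at h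
  refine h.congr' ?_
  filter_upwards [eventually_ge_atTop 1] with n hn
  have hn' : (0 : ℝ) < n := by exact_mod_cast hn
  have hs := sin_summationAngle_pos n
  have ha := summationAngle_pos n
  have hm := summationAngle_mul n
  have hK := two_mul_sin_mul_summationNorm n
  simp only [Pi.div_apply, Function.comp, Real.sinc_of_ne_zero ha.ne']
  have hK' : summationNorm n = 1 / (2 * Real.sin (summationAngle n)) := rfl
  rw [hK']
  have hpi : Real.pi = 2 * ((2 * n + 1) * summationAngle n) := by linarith
  rw [hpi]
  field_simp

end SummationMatrix

/-! ### Schur triangularization in an orthonormal basis. -/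

section Triangularization

open Module

theorem exists_orthonormalBasis_triangular {n : ℕ} :
    ∀ {E : Type} [NormedAddCommGroup E] [InnerProductSpace ℂ E] [FiniteDimensional ℂ E]
      (_ : finrank ℂ E = n) (f : E →ₗ[ℂ] E),
      ∃ b : OrthonormalBasis (Fin n) ℂ E,
        (∀ i j, j < i → inner ℂ (b i) (f (b j)) = 0) ∧
        ∀ i, End.HasEigenvalue f (inner ℂ (b i) (f (b i))) := by
  induction n with
  | zero =>
    intro E _ _ _ hE f
    exact ⟨(stdOrthonormalBasis ℂ E).reindex (finCongr hE), fun i => i.elim0, fun i => i.elim0⟩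
  | succ n ih =>
    intro E _ _ _ hE f
    have : Nontrivial E := nontrivial_of_finrank_pos (R := ℂ) (by omega)
    obtain ⟨μ, hμ⟩ := End.exists_eigenvalue f
    -- A vector orthogonal to the range of `f - μ` is an eigenvector of the adjoint, so `vᗮ` is
    -- invariant under `f`. Induction applies to `vᗮ`, and `v` becomes the last basis vector.
    obtain ⟨v, hv, hv1⟩ : ∃ v ∈ (LinearMap.range (f - algebraMap ℂ (End ℂ E) μ))ᗮ, ‖v‖ = 1 := by
      have hne : (LinearMap.range (f - algebraMap ℂ (End ℂ E) μ))ᗮ ≠ ⊥ := by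
        intro h
        rw [Submodule.orthogonal_eq_bot_iff, ← LinearMap.ker_eq_bot_iff_range_eq_top] at h
        exact hμ (by rw [← h]; exact End.eigenspace_def)
      obtain ⟨w, hw, hw0⟩ := Submodule.exists_mem_ne_zero_of_ne_bot hne
      refine ⟨((‖w‖ : ℂ)⁻¹) • w, Submodule.smul_mem _ _ hw, ?_⟩
      rw [norm_smul, norm_inv, Complex.norm_real, norm_norm, inv_mul_cancel₀ (norm_ne_zero_iff.2 hw0)]
    have hf : ∀ x, inner ℂ v (f x) = μ * inner ℂ v x := by
      intro x
      have := Submodule.inner_left_of_mem_orthogonal (LinearMap.mem_range_self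
        (f - algebraMap ℂ (End ℂ E) μ) x) hv
      simpa [inner_sub_right, inner_smul_right, sub_eq_zero, Module.algebraMap_end_apply] using this
    set W : Submodule ℂ E := (ℂ ∙ v)ᗮ with hW
    have hmem : ∀ x, x ∈ W ↔ inner ℂ v x = 0 := fun x => Submodule.mem_orthogonal_singleton_iff_inner_right
    have hWf : ∀ x ∈ W, f x ∈ W := fun x hx => by
      rw [hmem] at hx ⊢; rw [hf, hx, mul_zero]
    have hv0 : v ≠ 0 := by rintro rfl; simp at hv1
    have hWdim : finrank ℂ W = n := by
      have : Fact (finrank ℂ E = n + 1) := ⟨hE⟩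
      exact Submodule.finrank_orthogonal_span_singleton hv0
    obtain ⟨b, hb, hbe⟩ := ih hWdim (f.restrict hWf)
    have hvv : inner ℂ v v = (1 : ℂ) := by rw [inner_self_eq_norm_sq_to_K, hv1]; simp
    have hvb : ∀ i, inner ℂ v (b i : E) = 0 := fun i => (hmem _).1 (b i).2
    have hbv : ∀ i, inner ℂ (b i : E) v = 0 := fun i => inner_eq_zero_symm.1 (hvb i)
    set u : Fin (n + 1) → E := Fin.snoc (α := fun _ => E) (fun i => (b i : E)) v with hu
    have hucast : ∀ i, u (Fin.castSucc i) = b i := fun i => by simp [hu]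
    have hulast : u (Fin.last n) = v := by simp [hu]
    have hon : Orthonormal ℂ u := by
      rw [orthonormal_iff_ite]
      intro i j
      induction i using Fin.lastCases with
      | last =>
        induction j using Fin.lastCases with
        | last => rw [hulast, hvv, if_pos rfl]
        | cast j => simp [hulast, hucast, hvb, (Fin.castSucc_lt_last j).ne']
      | cast i =>
        induction j using Fin.lastCases with
        | last => simp [hulast, hucast, hbv, (Fin.castSucc_lt_last i).ne]
        | cast j =>
          have := (orthonormal_iff_ite.1 b.orthonormal) i j
          simpa [hucast] using this
    have hspan : ⊤ ≤ Submodule.span ℂ (Set.range u) := by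
      rw [hon.linearIndependent.span_eq_top_of_card_eq_finrank (by simp [hE])]
    have hb' : ∀ i, (OrthonormalBasis.mk hon hspan) i = u i := fun i => by simp
    refine ⟨OrthonormalBasis.mk hon hspan, ?_, ?_⟩
    · intro i j hij
      rw [hb', hb']
      induction j using Fin.lastCases with
      | last => exact absurd hij (Fin.le_last i).not_gt
      | cast j =>
        induction i using Fin.lastCases with
        | last => rw [hulast, hucast, hf, hvb, mul_zero]
        | cast i =>
          rw [hucast, hucast]
          exact hb i j (by simpa using hij)
    · intro i
      rw [hb']
      induction i using Fin.lastCases with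
      | last => rw [hulast, hf, hvv, mul_one]; exact hμ
      | cast i =>
        rw [hucast]
        obtain ⟨w, hw⟩ := (hbe i).exists_hasEigenvector
        refine End.hasEigenvalue_of_hasEigenvector (x := (w : E))
          (End.hasEigenvector_iff.2 ⟨End.mem_eigenspace_iff.2 ?_, ?_⟩)
        · exact congrArg Subtype.val hw.apply_eq_smul
        · simpa using hw.2

end Triangularization

/-! ### Upper bound for the resolvent of a contraction. -/

section UpperBound

theorem norm_inv_one_sub_le {r : ℝ} (hr1 : r < 1) {z : ℂ} (hz : ‖z‖ ≤ r) :
    ‖(1 - z)⁻¹‖ ≤ 1 / (1 - r) := by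
  have h : 1 - r ≤ ‖1 - z‖ := by
    have := norm_sub_norm_le (1 : ℂ) z
    rw [norm_one] at this
    linarith
  rw [norm_inv, ← one_div]
  exact one_div_le_one_div_of_le (by linarith) h

theorem two_mul_re_inv_one_sub_le {r : ℝ} (hr1 : r < 1) {z : ℂ} (hz : ‖z‖ ≤ r) :
    2 * ((1 - z)⁻¹).re - 1 ≤ (1 + r) / (1 - r) := by
  have h := (Complex.re_le_norm _).trans (norm_inv_one_sub_le hr1 hz)
  have : (1 + r) / (1 - r) = 2 * (1 / (1 - r)) - 1 := by
    have : 1 - r ≠ 0 := by linarith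
    field_simp; ring
  linarith

variable {E : Type} [NormedAddCommGroup E] [InnerProductSpace ℂ E]

/-- Expand `‖Bv - v‖ = ‖T(Bv)‖ ≤ ‖Bv‖`. -/
theorem norm_sq_le_two_mul_re_inner_of_contraction {T B : E →L[ℂ] E} (hT : ‖T‖ ≤ 1)
    (h : (1 - T) * B = 1) (v : E) : ‖v‖ ^ 2 ≤ 2 * (inner ℂ v (B v)).re := by
  have h₁ : T (B v) = B v - v := by
    have : B v - T (B v) = v := by simpa using congrArg (fun A : E →L[ℂ] E => A v) h
    rw [eq_sub_iff_add_eq', ← sub_eq_iff_eq_add.1 this]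
  have h₂ : ‖B v - v‖ ≤ ‖B v‖ := by
    rw [← h₁]
    exact (T.le_opNorm _).trans (mul_le_of_le_one_left (norm_nonneg _) hT)
  have h₃ := norm_sub_sq (𝕜 := ℂ) (B v) v
  have h₄ : RCLike.re (inner ℂ (B v) v) = (inner ℂ v (B v)).re := inner_re_symm (𝕜 := ℂ) _ _
  nlinarith [norm_nonneg (B v - v)]

/-- Positivity of `B + B* - 1` is tested on `e + c • f`, the unimodular `c` turning the off-diagonal
entry into minus its modulus. Since the entry at `(f, e)` vanishes, the off-diagonal entry of `B +
B* - 1` is that of `B`. -/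
theorem norm_inner_le_of_norm_sq_le {B : E →L[ℂ] E}
    (hB : ∀ v, ‖v‖ ^ 2 ≤ 2 * (inner ℂ v (B v)).re) {e f : E} (he : ‖e‖ = 1) (hf : ‖f‖ = 1)
    (hef : inner ℂ e f = 0) (hfe : inner ℂ f (B e) = 0) {P : ℝ}
    (hPe : 2 * (inner ℂ e (B e)).re - 1 ≤ P) (hPf : 2 * (inner ℂ f (B f)).re - 1 ≤ P) :
    ‖inner ℂ e (B f)‖ ≤ P := by
  obtain ⟨c, hc, hcz⟩ : ∃ c : ℂ, ‖c‖ = 1 ∧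
      c * inner ℂ e (B f) = -(‖inner ℂ e (B f)‖ : ℂ) := by
    generalize inner ℂ e (B f) = z
    by_cases hz : z = 0
    · exact ⟨1, by simp, by simp [hz]⟩
    · have hz' : (‖z‖ : ℂ) ≠ 0 := by simpa using hz
      refine ⟨-(‖z‖ : ℂ) / z, by simp [hz], by field_simp⟩
  have h := hB (e + c • f)
  have hn : ‖e + c • f‖ ^ 2 = 2 := by
    rw [norm_add_sq (𝕜 := ℂ), inner_smul_right, hef, norm_smul, hc, he, hf]
    norm_num
  rw [hn] at h
  simp only [map_add, map_smul, inner_add_left, inner_add_right, inner_smul_left,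
    inner_smul_right, mul_add, hfe, hcz, mul_zero, add_zero] at h
  have hcc : c * ((starRingEnd ℂ) c * inner ℂ f (B f)) = inner ℂ f (B f) := by
    rw [← mul_assoc, Complex.mul_conj', hc]; simp
  simp only [hcc, Complex.add_re, Complex.neg_re, Complex.ofReal_re] at h
  linarith

theorem norm_inverse_one_sub_le [FiniteDimensional ℂ E] {T B : E →L[ℂ] E} {r : ℝ} (hr0 : 0 < r)
    (hr1 : r < 1) (hT : ‖T‖ ≤ 1) (hTB : (1 - T) * B = 1)
    (hspec : ∀ z ∈ spectrum ℂ T, ‖z‖ ≤ r) :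
    ‖B‖ ≤ (1 + r) / (1 - r) * summationNorm (Module.finrank ℂ E) := by
  obtain ⟨b, hb, hbe⟩ := exists_orthonormalBasis_triangular (E := E) rfl (B : E →ₗ[ℂ] E)
  generalize Module.finrank ℂ E = n at b hb hbe ⊢
  simp only [ContinuousLinearMap.coe_coe] at hb hbe
  have hP : 0 < (1 + r) / (1 - r) := div_pos (by linarith) (by linarith)
  -- A diagonal entry `μ` is an eigenvalue of `B`, and its eigenvector is one of `T` for `1 - μ⁻¹`.
  have hdiag : ∀ i, ∃ z, ‖z‖ ≤ r ∧ inner ℂ (b i) (B (b i)) = (1 - z)⁻¹ := by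
    intro i
    obtain ⟨w, hw⟩ := (hbe i).exists_hasEigenvector
    generalize inner ℂ (b i) (B (b i)) = μ at hw
    have hw1 : B w = μ • w := hw.apply_eq_smul
    have hw0 : w ≠ 0 := hw.2
    have h₁ : w = μ • (w - T w) := by
      have := congrArg (fun A : E →L[ℂ] E => A w) hTB
      simpa [hw1, smul_sub] using this.symm
    have hμ : μ ≠ 0 := by rintro rfl; exact hw0 (by simpa using h₁)
    have h₂ : T w = (1 - μ⁻¹) • w := by
      have : μ⁻¹ • w = w - T w := by
        conv_lhs => rw [h₁]
        rw [smul_smul, inv_mul_cancel₀ hμ, one_smul]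
      rw [sub_smul, one_smul, this]; abel
    refine ⟨1 - μ⁻¹, hspec _ ?_, by simp⟩
    rw [spectrum.mem_iff]
    intro hu
    obtain ⟨C, hC⟩ := hu.exists_left_inv
    have := congrArg (fun A : E →L[ℂ] E => A w) hC
    simp only [mul_apply_eq_comp, sub_apply, h₂,
      one_apply_eq_self, ContinuousLinearMap.algebraMap_apply, sub_self, map_zero] at this
    exact hw0 this.symm
  have hdre : ∀ i, 2 * (inner ℂ (b i) (B (b i))).re - 1 ≤ (1 + r) / (1 - r) := by
    intro i
    obtain ⟨z, hz, hzi⟩ := hdiag i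
    rw [hzi]
    exact two_mul_re_inv_one_sub_le hr1 hz
  have hentry : ∀ i j, ‖inner ℂ (b i) (B (b j))‖ ≤ if i ≤ j then (1 + r) / (1 - r) else 0 := by
    intro i j
    rcases lt_trichotomy i j with h | h | h
    · rw [if_pos h.le]
      exact norm_inner_le_of_norm_sq_le (norm_sq_le_two_mul_re_inner_of_contraction hT hTB)
        (b.norm_eq_one i) (b.norm_eq_one j) (b.inner_eq_zero h.ne) (hb j i h) (hdre i) (hdre j)
    · subst h
      rw [if_pos le_rfl]
      obtain ⟨z, hz, hzi⟩ := hdiag i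
      rw [hzi]
      refine (norm_inv_one_sub_le hr1 hz).trans ?_
      gcongr
      linarith
    · rw [if_neg h.not_ge, hb i j h, norm_zero]
  refine ContinuousLinearMap.opNorm_le_bound _ (mul_nonneg hP.le (summationNorm_pos n).le) fun x => ?_
  refine le_of_sq_le_sq ?_ (by have := summationNorm_pos n; positivity)
  -- Entrywise domination reduces the norm to the real matrix of ones acting on the moduli of the
  -- coordinates.
  have hrow : ∀ i, ‖inner ℂ (b i) (B x)‖ ≤
      (1 + r) / (1 - r) * ∑ j, if i ≤ j then ‖inner ℂ (b j) x‖ else 0 := by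
    intro i
    conv_lhs => rw [← b.sum_repr' x, map_sum, inner_sum]
    rw [Finset.mul_sum]
    refine (norm_sum_le _ _).trans (Finset.sum_le_sum fun j _ => ?_)
    rw [map_smul, inner_smul_right, norm_mul]
    have := mul_le_mul_of_nonneg_left (hentry i j) (norm_nonneg (inner ℂ (b j) x))
    refine this.trans_eq ?_
    split_ifs <;> ring
  calc ‖B x‖ ^ 2 = ∑ i, ‖inner ℂ (b i) (B x)‖ ^ 2 := (b.sum_sq_norm_inner_right _).symm
    _ ≤ ∑ i, ((1 + r) / (1 - r) * ∑ j, if i ≤ j then ‖inner ℂ (b j) x‖ else 0) ^ 2 :=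
        Finset.sum_le_sum fun i _ => pow_le_pow_left₀ (norm_nonneg _) (hrow i) 2
    _ = ((1 + r) / (1 - r)) ^ 2 * ∑ i, (∑ j, if i ≤ j then ‖inner ℂ (b j) x‖ else 0) ^ 2 := by
        rw [Finset.mul_sum]; simp_rw [mul_pow]
    _ ≤ ((1 + r) / (1 - r)) ^ 2 * (summationNorm n ^ 2 * ∑ j, ‖inner ℂ (b j) x‖ ^ 2) := by
        gcongr
        exact sum_sq_partialSum_le _
    _ = ((1 + r) / (1 - r) * summationNorm n * ‖x‖) ^ 2 := by
        rw [b.sum_sq_norm_inner_right]; ring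

end UpperBound

/-! ### Lower bound from a Möbius transform of the Jordan block. -/

section LowerBound

open scoped Matrix.Norms.L2Operator

variable {n : ℕ}

/-- The `n × n` nilpotent Jordan block. -/
def nilpotentJordanBlock (n : ℕ) : Matrix (Fin n) (Fin n) ℂ :=
  Matrix.of fun i j => if (i : ℕ) + 1 = j then 1 else 0

/-- The `n × n` upper triangular matrix all of whose nonzero entries are `1`. -/
def summationMatrix (n : ℕ) : Matrix (Fin n) (Fin n) ℂ :=
  Matrix.of fun i j => if i ≤ j then 1 else 0

theorem nilpotentJordanBlock_mul_apply (A : Matrix (Fin n) (Fin n) ℂ) (i j : Fin n) :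
    (nilpotentJordanBlock n * A) i j = if h : (i : ℕ) + 1 < n then A ⟨i + 1, h⟩ j else 0 := by
  rw [Matrix.mul_apply]
  simp only [nilpotentJordanBlock, Matrix.of_apply, ite_mul, one_mul, zero_mul]
  split_ifs with h
  · rw [Finset.sum_eq_single ⟨i + 1, h⟩]
    · simp
    · intro k _ hk
      rw [if_neg]
      intro h'
      exact hk (Fin.ext h'.symm)
    · simp
  · refine Finset.sum_eq_zero fun k _ => if_neg ?_
    have := k.2
    omega

theorem nilpotentJordanBlock_pow_apply (k : ℕ) (i j : Fin n) :
    (nilpotentJordanBlock n ^ k) i j = if (i : ℕ) + k = j then 1 else 0 := by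
  induction k generalizing i with
  | zero => simp [Matrix.one_apply, Fin.ext_iff]
  | succ k ih =>
    rw [pow_succ', nilpotentJordanBlock_mul_apply]
    split_ifs with h h' h'
    · rw [ih, if_pos]; simp only; omega
    · rw [ih, if_neg]; simp only; omega
    · have := j.2; omega
    · rfl

theorem isNilpotent_nilpotentJordanBlock (n : ℕ) : IsNilpotent (nilpotentJordanBlock n) := by
  refine ⟨n, ?_⟩
  ext i j
  rw [nilpotentJordanBlock_pow_apply, if_neg, Matrix.zero_apply]
  have := j.2
  omega

theorem norm_nilpotentJordanBlock_le (n : ℕ) : ‖nilpotentJordanBlock n‖ ≤ 1 := by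
  have h : nilpotentJordanBlock n * (nilpotentJordanBlock n).conjTranspose =
      Matrix.diagonal fun i : Fin n => if (i : ℕ) + 1 < n then 1 else 0 := by
    ext i j
    rw [nilpotentJordanBlock_mul_apply, Matrix.diagonal_apply]
    simp only [Matrix.conjTranspose_apply, nilpotentJordanBlock, Matrix.of_apply, Fin.ext_iff,
      add_left_inj]
    split_ifs with h₁ h₂ h₂ h₂ h₂ <;> first | omega | simp
  have h' := Matrix.l2_opNorm_conjTranspose_mul_self (nilpotentJordanBlock n).conjTranspose
  rw [Matrix.conjTranspose_conjTranspose, h, Matrix.l2_opNorm_diagonal,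
    Matrix.l2_opNorm_conjTranspose] at h'
  have : ‖fun i : Fin n => if (i : ℕ) + 1 < n then (1 : ℂ) else 0‖ ≤ 1 := by
    rw [pi_norm_le_iff_of_nonneg zero_le_one]
    intro i
    split_ifs <;> simp
  nlinarith

theorem one_sub_nilpotentJordanBlock_mul_summationMatrix (n : ℕ) :
    (1 - nilpotentJordanBlock n) * summationMatrix n = 1 := by
  rw [sub_mul, one_mul]
  ext i j
  rw [Matrix.sub_apply, nilpotentJordanBlock_mul_apply, Matrix.one_apply]
  have := j.2
  simp only [summationMatrix, Matrix.of_apply, Fin.le_def, Fin.ext_iff]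
  split_ifs <;> first | omega | simp

theorem summationNorm_le_norm_summationMatrix (hn : 1 ≤ n) :
    summationNorm n ≤ ‖summationMatrix n‖ := by
  set s : Fin n → ℝ := fun j => Real.sin (2 * ((j : ℕ) + 1) * summationAngle n) with hs
  set x : EuclideanSpace ℂ (Fin n) := WithLp.toLp 2 fun j => (s j : ℂ) with hx
  have hxn : ‖x‖ ^ 2 = ∑ j, s j ^ 2 := by
    simp [EuclideanSpace.norm_sq_eq, hx]
  have hx0 : 0 < ‖x‖ := by
    refine lt_of_pow_lt_pow_left₀ 2 (norm_nonneg x) ?_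
    rw [hxn, zero_pow two_ne_zero]
    exact Finset.sum_pos (fun j _ => pow_pos (sin_singular_pos j) 2) ⟨⟨0, hn⟩, Finset.mem_univ _⟩
  have hSx : ‖Matrix.toEuclideanCLM (n := Fin n) (𝕜 := ℂ) (summationMatrix n) x‖ ^ 2 =
      (summationNorm n * ‖x‖) ^ 2 := by
    rw [mul_pow, hxn, ← sum_sq_partialSum_sin, EuclideanSpace.norm_sq_eq]
    refine Finset.sum_congr rfl fun i _ => ?_
    have : (Matrix.toEuclideanCLM (n := Fin n) (𝕜 := ℂ) (summationMatrix n) x) i =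
        ((∑ j, if i ≤ j then s j else 0 : ℝ) : ℂ) := by
      change (Matrix.mulVec (summationMatrix n) fun j => (s j : ℂ)) i = _
      rw [Complex.ofReal_sum, Matrix.mulVec_eq_sum, Finset.sum_apply]
      refine Finset.sum_congr rfl fun j _ => ?_
      by_cases h : i ≤ j <;> simp [summationMatrix, h]
    rw [this, Complex.norm_real, Real.norm_eq_abs, sq_abs]
  have hSx' := (sq_eq_sq₀ (norm_nonneg _)
    (mul_nonneg (summationNorm_pos n).le hx0.le)).1 hSx
  have h := (Matrix.toEuclideanCLM (n := Fin n) (𝕜 := ℂ) (summationMatrix n)).le_opNorm x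
  rw [hSx'] at h
  exact le_of_mul_le_mul_right h hx0

/-- The difference of squares is `(1 - r²)(‖x‖² - ‖y‖²)`. With `y = Jx` this says that the Möbius
transform of a contraction is a contraction. -/
theorem norm_add_smul_le_norm_add_smul {E : Type*} [NormedAddCommGroup E] [InnerProductSpace ℂ E]
    {x y : E} (h : ‖y‖ ≤ ‖x‖) {r : ℝ} (hr0 : 0 ≤ r) (hr1 : r ≤ 1) :
    ‖y + (r : ℂ) • x‖ ≤ ‖x + (r : ℂ) • y‖ := by
  refine le_of_sq_le_sq ?_ (norm_nonneg _)
  have hsymm : RCLike.re (inner ℂ x y) = RCLike.re (inner ℂ y x) := inner_re_symm (𝕜 := ℂ) _ _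
  rw [norm_add_sq (𝕜 := ℂ), norm_add_sq (𝕜 := ℂ), inner_smul_right, inner_smul_right,
    norm_smul, norm_smul, Complex.norm_real, Real.norm_of_nonneg hr0]
  simp only [RCLike.re_to_complex, Complex.re_ofReal_mul] at hsymm ⊢
  rw [hsymm]
  have h₁ : ‖y‖ ^ 2 ≤ ‖x‖ ^ 2 := by gcongr
  have h₂ : r ^ 2 ≤ 1 := by nlinarith
  nlinarith [mul_nonneg (sub_nonneg.2 h₁) (sub_nonneg.2 h₂)]

theorem exists_mem_resolventNorms_ge {r : ℝ} (hr0 : 0 < r) (hr1 : r < 1) (hn : 1 ≤ n) :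
    ∃ x ∈ resolventNorms n r 1, ((1 + r) * summationNorm n - r) / (1 - r) ≤ x := by
  set J := nilpotentJordanBlock n with hJ
  have hJnil : IsNilpotent J := isNilpotent_nilpotentJordanBlock n
  -- A nonzero scalar plus a commuting nilpotent is invertible; this gives both `(1 + rJ)⁻¹` and the
  -- spectrum of `T`.
  have hunit : ∀ a b : ℂ, a ≠ 0 → IsUnit (a • (1 : Matrix (Fin n) (Fin n) ℂ) + b • J) := by
    intro a b ha
    refine IsNilpotent.isUnit_add_left_of_commute (hJnil.smul b) ?_ ?_
    · exact (isUnit_one (M := Matrix (Fin n) (Fin n) ℂ)).smul (Units.mk0 a ha)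
    · exact ((Commute.one_right _).smul_right a)
  obtain ⟨u, hu⟩ := hunit 1 r one_ne_zero
  rw [one_smul] at hu
  set M : Matrix (Fin n) (Fin n) ℂ := ↑u⁻¹ with hM
  have hM₁ : (1 + (r : ℂ) • J) * M = 1 := by rw [← hu, hM, Units.mul_inv]
  have hM₂ : M * (1 + (r : ℂ) • J) = 1 := by rw [← hu, hM, Units.inv_mul]
  set T := (J + (r : ℂ) • 1) * M with hT
  have hr : (1 - (r : ℂ)) ≠ 0 := by
    rw [← Complex.ofReal_one, ← Complex.ofReal_sub, Complex.ofReal_ne_zero]; linarith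
  have hsub : ∀ z : ℂ, z • 1 - T = ((z - r) • 1 + (z * r - 1) • J) * M := by
    intro z
    have : z • (1 : Matrix (Fin n) (Fin n) ℂ) = (z • (1 + (r : ℂ) • J)) * M := by
      rw [smul_mul_assoc, hM₁]
    rw [this, hT, ← sub_mul]
    congr 1
    module
  have hspec : ∀ z ∈ spectrum ℂ T, z = r := by
    intro z hz
    by_contra hne
    apply hz
    rw [spectrum.mem_resolventSet_iff, Algebra.algebraMap_eq_smul_one, hsub]
    exact (hunit _ _ (sub_ne_zero.2 hne)).mul u⁻¹.isUnit
  set R := (1 - (r : ℂ))⁻¹ • ((1 + (r : ℂ)) • summationMatrix n - (r : ℂ) • 1) with hR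
  have hS := one_sub_nilpotentJordanBlock_mul_summationMatrix n
  have hTR : (1 - T) * R = 1 := by
    -- Replace the identity by `S - JS`; the factor `1 + rJ` then cancels against `M` in `1 - T = (1
    -- - r)(1 - J)M`.
    have h₁ : (1 + (r : ℂ)) • summationMatrix n - (r : ℂ) • 1 =
        (1 + (r : ℂ) • J) * summationMatrix n := by
      have hS' : summationMatrix n - J * summationMatrix n = 1 := by
        rw [← hS, sub_mul, one_mul]
      conv_lhs => rw [← hS']
      rw [add_mul, one_mul, smul_mul_assoc]
      module
    have h₂ : 1 - T = (1 - (r : ℂ)) • ((1 - J) * M) := by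
      have := hsub 1
      rw [one_smul] at this
      rw [this, ← smul_mul_assoc]
      congr 1
      module
    rw [hR, h₁, h₂, smul_mul_smul_comm, mul_inv_cancel₀ hr, one_smul, mul_assoc, ← mul_assoc M,
      hM₂, one_mul, hS]
  have hres : resolvent T (1 : ℂ) = R := by
    rw [resolvent, map_one, ← Matrix.nonsing_inv_eq_ringInverse]
    exact Matrix.inv_eq_right_inv hTR
  refine ⟨_, ⟨T, ?_, ?_, rfl⟩, ?_⟩
  · refine ContinuousLinearMap.opNorm_le_bound _ zero_le_one fun x => ?_
    set m := Matrix.toEuclideanCLM (n := Fin n) (𝕜 := ℂ) M with hm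
    set j := Matrix.toEuclideanCLM (n := Fin n) (𝕜 := ℂ) J with hj
    have h₁ : Matrix.toEuclideanCLM (n := Fin n) (𝕜 := ℂ) T x = j (m x) + (r : ℂ) • m x := by
      rw [hT, map_mul, map_add, map_smul, map_one]; rfl
    have h₂ : x = m x + (r : ℂ) • j (m x) := by
      have := congrArg (fun A => Matrix.toEuclideanCLM (n := Fin n) (𝕜 := ℂ) A x) hM₁
      simp only [map_mul, map_add, map_smul, map_one] at this
      exact this.symm
    rw [one_mul, h₁]
    conv_rhs => rw [h₂]
    refine norm_add_smul_le_norm_add_smul ?_ hr0.le hr1.le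
    exact (j.le_opNorm _).trans
      (mul_le_of_le_one_left (norm_nonneg _) (norm_nilpotentJordanBlock_le n))
  · refine iSup₂_le fun z hz => ?_
    rw [hspec z hz, ENNReal.ofReal, ENNReal.coe_le_coe, ← NNReal.coe_le_coe]
    simp [abs_of_pos hr0, hr0.le]
  · rw [hres]
    change _ ≤ ‖R‖
    have h₁ : (1 + (r : ℂ)) • summationMatrix n = (1 - (r : ℂ)) • R + (r : ℂ) • 1 := by
      rw [hR, smul_smul, mul_inv_cancel₀ hr, one_smul, sub_add_cancel]
    have h₂ := norm_add_le ((1 - (r : ℂ)) • R) ((r : ℂ) • 1)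
    have e₁ : ‖(1 + (r : ℂ))‖ = 1 + r := by
      rw [← Complex.ofReal_one, ← Complex.ofReal_add, Complex.norm_real,
        Real.norm_of_nonneg (by linarith)]
    have e₂ : ‖(1 - (r : ℂ))‖ = 1 - r := by
      rw [← Complex.ofReal_one, ← Complex.ofReal_sub, Complex.norm_real,
        Real.norm_of_nonneg (by linarith)]
    have hone : ‖(1 : Matrix (Fin n) (Fin n) ℂ)‖ ≤ 1 := by
      rw [← Matrix.l2_opNorm_toEuclideanCLM, map_one]
      exact ContinuousLinearMap.norm_id_le
    rw [← h₁, norm_smul, norm_smul _ R, norm_smul (r : ℂ), e₁, e₂, Complex.norm_real,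
      Real.norm_of_nonneg hr0.le] at h₂
    rw [div_le_iff₀ (by linarith)]
    have h₃ := summationNorm_le_norm_summationMatrix hn
    nlinarith [mul_le_mul_of_nonneg_left h₃ (by linarith : 0 ≤ 1 + r),
      mul_le_mul_of_nonneg_left hone hr0.le]

end LowerBound

/-! ### Rotation invariance, the supremum and its asymptotics. -/

section Resolvent

variable {n : ℕ} {r : ℝ}

theorem norm_le_of_mem_spectrum_of_spectralRadius_le {A : Type*} [Ring A] [Algebra ℂ A]
    (hr0 : 0 ≤ r) {a : A} (h : spectralRadius ℂ a ≤ ENNReal.ofReal r) {z : ℂ}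
    (hz : z ∈ spectrum ℂ a) : ‖z‖ ≤ r := by
  have := (le_iSup₂ (f := fun k (_ : k ∈ spectrum ℂ a) => (‖k‖₊ : ENNReal)) z hz).trans h
  rw [ENNReal.ofReal, ENNReal.coe_le_coe, ← NNReal.coe_le_coe, Real.coe_toNNReal _ hr0] at this
  simpa using this

theorem spectralRadius_unitary_smul {A : Type*} [Ring A] [Algebra ℂ A] (u : ℂˣ)
    (hu : ‖(u : ℂ)‖ = 1) (a : A) : spectralRadius ℂ (u • a) ≤ spectralRadius ℂ a := by
  refine iSup₂_le fun z hz => ?_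
  rw [spectrum.unit_smul_eq_smul] at hz
  obtain ⟨w, hw, rfl⟩ := hz
  have : ‖u • w‖₊ = ‖w‖₊ := by
    rw [← NNReal.coe_inj, Units.smul_def]
    simp [hu]
  change ((‖u • w‖₊ : NNReal) : ENNReal) ≤ _
  rw [this]
  exact le_iSup₂ (f := fun k (_ : k ∈ spectrum ℂ a) => (‖k‖₊ : ENNReal)) w hw

theorem hilbertOpNorm_units_smul (u : ℂˣ) (hu : ‖(u : ℂ)‖ = 1)
    (A : Matrix (Fin n) (Fin n) ℂ) : hilbertOpNorm (u • A) = hilbertOpNorm A := by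
  rw [hilbertOpNorm, hilbertOpNorm, Units.smul_def, map_smul, norm_smul, hu, one_mul]

/-- The rotation `T ↦ ζ⁻¹T` preserves both constraints and changes the resolvent only by a
unimodular factor. -/
theorem resolventNorms_eq {ζ : ℂ} (hζ : ‖ζ‖ = 1) :
    resolventNorms n r ζ = resolventNorms n r 1 := by
  have hζ0 : ζ ≠ 0 := by rintro rfl; simp at hζ
  set u : ℂˣ := Units.mk0 ζ hζ0
  have hu : ‖(u : ℂ)‖ = 1 := hζ
  have hu' : ‖((u⁻¹ : ℂˣ) : ℂ)‖ = 1 := by simp [u, hζ]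
  have key : ∀ T : Matrix (Fin n) (Fin n) ℂ,
      hilbertOpNorm (resolvent T ζ) = hilbertOpNorm (resolvent (u⁻¹ • T) (1 : ℂ)) := by
    intro T
    rw [← spectrum.units_smul_resolvent_self, hilbertOpNorm_units_smul u hu]
    rfl
  ext x
  constructor
  · rintro ⟨T, hT, hs, rfl⟩
    exact ⟨u⁻¹ • T, by rwa [hilbertOpNorm_units_smul _ hu'],
      (spectralRadius_unitary_smul _ hu' T).trans hs, key T⟩
  · rintro ⟨T, hT, hs, rfl⟩
    refine ⟨u • T, by rwa [hilbertOpNorm_units_smul _ hu],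
      (spectralRadius_unitary_smul _ hu T).trans hs, ?_⟩
    rw [key, inv_smul_smul]

theorem le_of_mem_resolventNorms (hr0 : 0 < r) (hr1 : r < 1) {x : ℝ}
    (hx : x ∈ resolventNorms n r 1) : x ≤ (1 + r) / (1 - r) * summationNorm n := by
  obtain ⟨T, hT, hs, rfl⟩ := hx
  have hspec : ∀ z ∈ spectrum ℂ T, ‖z‖ ≤ r :=
    fun z hz => norm_le_of_mem_spectrum_of_spectralRadius_le hr0.le hs hz
  have hunit : IsUnit (1 - T) := by
    have : (1 : ℂ) ∈ resolventSet ℂ T := by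
      by_contra h
      have := hspec 1 h
      rw [norm_one] at this
      linarith
    simpa using spectrum.mem_resolventSet_iff.1 this
  have hTB : (1 - T) * resolvent T (1 : ℂ) = 1 := by
    rw [resolvent, map_one]
    exact Ring.mul_inverse_cancel _ hunit
  have h := norm_inverse_one_sub_le (T := Matrix.toEuclideanCLM (n := Fin n) (𝕜 := ℂ) T)
    (B := Matrix.toEuclideanCLM (n := Fin n) (𝕜 := ℂ) (resolvent T (1 : ℂ))) hr0 hr1 hT
    (by rw [← map_one (Matrix.toEuclideanCLM (n := Fin n) (𝕜 := ℂ)), ← map_sub, ← map_mul, hTB])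
    (by rw [AlgEquiv.spectrum_eq]; exact hspec)
  simpa [hilbertOpNorm] using h

theorem isLUB_resolventSup (hr0 : 0 < r) (hr1 : r < 1) (hn : 1 ≤ n) :
    IsLUB (resolventNorms n r 1) (resolventSup n r) := by
  obtain ⟨x, hx, -⟩ := exists_mem_resolventNorms_ge hr0 hr1 hn
  exact isLUB_csSup ⟨x, hx⟩ ⟨_, fun y hy => le_of_mem_resolventNorms hr0 hr1 hy⟩

theorem resolventSup_isEquivalent (hr0 : 0 < r) (hr1 : r < 1) :
    (fun n : ℕ => resolventSup n r) ~[atTop]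
      (fun n : ℕ => 2 / Real.pi * ((1 + r) / (1 - r)) * (n : ℝ)) := by
  have hr : 1 - r ≠ 0 := by linarith
  have hP : 0 < (1 + r) / (1 - r) := div_pos (by linarith) (by linarith)
  set C := 2 / Real.pi * ((1 + r) / (1 - r)) with hC
  have hC0 : C ≠ 0 := by have := Real.pi_pos; positivity
  have hlim : Tendsto (fun n : ℕ => resolventSup n r / n) atTop (nhds C) := by
    have hup := tendsto_summationNorm_div.const_mul ((1 + r) / (1 - r))
    have h₀ : Tendsto (fun n : ℕ => r / (1 - r) * ((n : ℝ))⁻¹) atTop (nhds 0) := by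
      simpa using (tendsto_inv_atTop_zero.comp (tendsto_natCast_atTop_atTop (R := ℝ))).const_mul
        (r / (1 - r))
    have hlow := hup.sub h₀
    rw [sub_zero] at hlow
    rw [mul_comm ((1 + r) / (1 - r))] at hup hlow
    -- The two bounds differ by the constant `r / (1 - r)`, which vanishes after division by `n`.
    refine tendsto_of_tendsto_of_tendsto_of_le_of_le' hlow hup ?_ ?_
    · filter_upwards [eventually_ge_atTop 1] with n hn
      have hn' : (0 : ℝ) < n := by exact_mod_cast hn
      obtain ⟨x, hx, hxle⟩ := exists_mem_resolventNorms_ge hr0 hr1 hn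
      have := hxle.trans ((isLUB_resolventSup hr0 hr1 hn).1 hx)
      rw [le_div_iff₀ hn']
      refine le_trans (le_of_eq ?_) this
      field_simp
    · filter_upwards [eventually_ge_atTop 1] with n hn
      have hn' : (0 : ℝ) < n := by exact_mod_cast hn
      have := (isLUB_resolventSup hr0 hr1 hn).2
        (fun y hy => le_of_mem_resolventNorms hr0 hr1 hy)
      rw [← mul_div_assoc]
      gcongr
  rw [isEquivalent_iff_tendsto_one]
  · have h := hlim.div_const C
    rw [div_self hC0] at h
    refine h.congr fun n => ?_
    rw [Pi.div_apply, div_div, mul_comm C]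
  · filter_upwards [eventually_ge_atTop 1] with n hn
    have hn' : (n : ℝ) ≠ 0 := by positivity
    exact mul_ne_zero hC0 hn'

end Resolvent

theorem theorem2 (r : ℝ) (hr0 : 0 < r) (hr1 : r < 1) :
    (∀ n : ℕ, 1 ≤ n → ∀ ζ : ℂ, ‖ζ‖ = 1 → IsLUB (resolventNorms n r ζ) (resolventSup n r)) ∧
    (fun n : ℕ => resolventSup n r) ~[atTop]
      (fun n : ℕ => 2 / Real.pi * ((1 + r) / (1 - r)) * (n : ℝ)) := by
  refine ⟨fun n hn ζ hζ => ?_, resolventSup_isEquivalent hr0 hr1⟩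
  rw [resolventNorms_eq hζ]
  exact isLUB_resolventSup hr0 hr1 hn
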